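/- Let $n\geq 2$. Let $\mathsf{Path}_n$ be the path graph with $n$ vertices and vertex set $V$, and let $\mathsf{Cycle}_n$ be the cycle graph with vertex set $\mathbb Z/n\mathbb Z$ and edges $\{i,i+1\}$, where the vertices $1,2,\ldots,n$ appear in this order clockwise. A labeling of $\mathsf{Path}_n$ is a bijection $\sigma\colon V\to\mathbb Z/n\mathbb Z$. For $i\in\mathbb Z/n\mathbb Z$, the toggle $\tau_i$ is the involution on the set $\Lambda$ of labelings defined by $\tau_i(\sigma)=\sigma$ if $\sigma^{-1}(i)$ and $\sigma^{-1}(i+1)$ are adjacent in $\mathsf{Path}_n$, and $\tau_i(\sigma)=(i\;\,i+1)\circ\sigma$ otherwise. For a bijection $\pi\colon\{1,\ldots,n\}\to\mathbb Z/n\mathbb Z$, let $\mathrm{TPro}_\pi=\tau_{\pi(n)}\cdots\tau_{\pi(2)}\tau_{\pi(1)}$ (composition of maps, $\tau_{\pi(1)}$ acting first), and let $\alpha_\pi$ be the acyclic orientation of $\mathsf{Cycle}_n$ in which each edge $\{u,v\}$ is oriented from $u$ to $v$ if and only if $\pi^{-1}(u)<\pi^{-1}(v)$. Every acyclic orientation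 $\beta$ of $\mathsf{Cycle}_n$ equals $\alpha_\pi$ for some $\pi$, and $\mathrm{TPro}_\pi$ depends only on $\alpha_\pi$; write $\mathrm{TPro}_\beta$ for $\mathrm{TPro}_\pi$ with any $\pi$ such that $\alpha_\pi=\beta$. Proposition 5.1. Let $\beta$ be an acyclic orientation of $\mathsf{Cycle}_n$, and let $d$ be the number of edges oriented counterclockwise, that is, the number of $i\in\mathbb Z/n\mathbb Z$ such that $\beta$ contains the arrow $i+1\to i$. Then every orbit of $\mathrm{TPro}_\beta\colon\Lambda\to\Lambda$ has size divisible by $\operatorname{lcm}(d,n-d)$. -/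

import Mathlib

namespace Permutoric

/-- A labeling of a graph with vertex set `V` (with `n` vertices): a bijection `V → ℤ/nℤ`. -/
abbrev Labeling (V : Type*) (n : ℕ) := V ≃ ZMod n

section Toggle

variable {V : Type*} {n : ℕ}

open Classical in
/-- The toggle `τ_i` as a map: it swaps the labels `i` and `i + 1` if the vertices carrying them
are not adjacent in `G`, and does nothing otherwise. -/
noncomputable def toggleFun (G : SimpleGraph V) (i : ZMod n) (σ : Labeling V n) : Labeling V n :=
  if G.Adj (σ.symm i) (σ.symm (i + 1)) then σ else σ.trans (Equiv.swap i (i + 1))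

theorem toggleFun_involutive (G : SimpleGraph V) (i : ZMod n) :
    Function.Involutive (toggleFun G i) := by
  intro σ
  by_cases h : G.Adj (σ.symm i) (σ.symm (i + 1))
  · simp [toggleFun, h]
  · have h' : ¬ G.Adj (σ.symm (i + 1)) (σ.symm i) := fun hh => h hh.symm
    ext v
    simp [toggleFun, h, h']

/-- The toggle `τ_i`, as a permutation of the set of labelings of `G`. -/
noncomputable def toggle (G : SimpleGraph V) (i : ZMod n) : Equiv.Perm (Labeling V n) :=
  (toggleFun_involutive G i).toPerm

/-- Permutoric promotion `TPro_π = τ_{π(n)} ⋯ τ_{π(2)} τ_{π(1)}` (a product in `Equiv.Perm` is a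
composition, so the factor of the first position acts first). The set `[n]` of positions is
replaced by `Fin n` with its usual order. -/
noncomputable def tproPerm (G : SimpleGraph V) (π : Fin n ≃ ZMod n) :
    Equiv.Perm (Labeling V n) :=
  (List.ofFn fun k => toggle G (π k)).reverse.prod

end Toggle

/-- An acyclic orientation of a simple graph `G`: every edge of `G` is given exactly one of its two
directions, and there is no directed cycle. -/
structure AcyclicOrientation {V : Type*} (G : SimpleGraph V) extends Digraph V where
  adj_of_arrow : ∀ u v, Adj u v → G.Adj u v
  arrow_iff : ∀ u v, G.Adj u v → (Adj u v ↔ ¬ Adj v u)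
  acyclic : ∀ v, ¬ Relation.TransGen Adj v v

/-- The cycle graph on `ℤ/nℤ`, with edges `{i, i + 1}`. Clockwise is the direction
from `i` to `i + 1`. -/
def cycle (n : ℕ) : SimpleGraph (ZMod n) := SimpleGraph.circulantGraph {1}

/-- The number of edges that are oriented counterclockwise, i.e. of the arrows `i + 1 → i`. -/
noncomputable def numCounterclockwise {n : ℕ} (β : AcyclicOrientation (cycle n)) : ℕ :=
  {i : ZMod n | β.Adj (i + 1) i}.ncard

/-- The acyclic orientation `α_π` of the cycle: the arrow of an edge goes from the endpoint
that comes first in `π(1), …, π(n)` to the one that comes later. -/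
def alpha {n : ℕ} (π : Fin n ≃ ZMod n) : AcyclicOrientation (cycle n) where
  Adj u v := (cycle n).Adj u v ∧ π.symm u < π.symm v
  adj_of_arrow _ _ h := h.1
  arrow_iff u v h := by
    have hne : π.symm u ≠ π.symm v := fun e => h.ne (π.symm.injective e)
    simp only [h, h.symm, true_and, not_lt]
    exact ⟨le_of_lt, fun hle => lt_of_le_of_ne hle hne⟩
  acyclic v h := by
    have key : ∀ w, Relation.TransGen
        (fun a b => (cycle n).Adj a b ∧ π.symm a < π.symm b) v w → π.symm v < π.symm w := by
      intro w hw
      induction hw with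
      | single h => exact h.2
      | tail _ h ih => exact ih.trans h.2
    exact lt_irrefl _ (key v h)

theorem AcyclicOrientation.ext_adj {V : Type*} {G : SimpleGraph V} {β γ : AcyclicOrientation G}
    (h : ∀ u v, β.Adj u v ↔ γ.Adj u v) : β = γ := by
  obtain ⟨⟨a⟩, _, _, _⟩ := β
  obtain ⟨⟨b⟩, _, _, _⟩ := γ
  have : a = b := by
    funext u v
    exact propext (h u v)
  subst this
  rfl

/-- Every acyclic orientation of the cycle is `α_π` for some bijection `π`. -/
theorem exists_alpha_eq {n : ℕ} [NeZero n] (β : AcyclicOrientation (cycle n)) :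
    ∃ π : Fin n ≃ ZMod n, alpha π = β := by
  classical
  let r : ZMod n → ZMod n → Prop := Relation.ReflTransGen β.Adj
  have hanti : ∀ a b, r a b → r b a → a = b := by
    intro a b hab hba
    rcases Relation.reflTransGen_iff_eq_or_transGen.1 hab with h | h
    · exact h.symm
    · exact absurd (h.trans_left hba) (β.acyclic a)
  let P : PartialOrder (ZMod n) :=
    { le := r
      le_refl := fun _ => Relation.ReflTransGen.refl
      le_trans := fun _ _ _ h h' => Relation.ReflTransGen.trans h h'
      le_antisymm := hanti }
  have : Fintype (LinearExtension (ZMod n)) := inferInstanceAs (Fintype (ZMod n))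
  have hcard : Fintype.card (LinearExtension (ZMod n)) = n := by
    rw [← Nat.card_eq_fintype_card]
    exact Nat.card_zmod n
  let e : Fin n ≃o LinearExtension (ZMod n) := monoEquivOfFin _ hcard
  let π : Fin n ≃ ZMod n := e.toEquiv
  have hlt : ∀ u v, β.Adj u v → π.symm u < π.symm v := by
    intro u v h
    have hle : (toLinearExtension u) ≤ (toLinearExtension v : LinearExtension (ZMod n)) :=
      toLinearExtension.monotone' (Relation.ReflTransGen.single h : r u v)
    have h1 : π.symm u ≤ π.symm v := e.symm.monotone hle
    exact lt_of_le_of_ne h1 fun e' => (β.adj_of_arrow u v h).ne (π.symm.injective e')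
  refine ⟨π, AcyclicOrientation.ext_adj fun u v => ⟨fun h => ?_, fun h => ?_⟩⟩
  · by_contra hn
    have hvu : β.Adj v u := by
      by_contra hvu
      exact hn ((β.arrow_iff u v h.1).2 hvu)
    exact lt_asymm h.2 (hlt v u hvu)
  · exact ⟨β.adj_of_arrow u v h, hlt u v h⟩

/-- The operator `TPro_β`: it is `TPro_π` for a bijection `π` with `α_π = β`. By
`tpro_eq_tproPerm` below, all such `π` give the same operator. -/
noncomputable def tpro {V : Type*} {n : ℕ} [NeZero n] (G : SimpleGraph V)
    (β : AcyclicOrientation (cycle n)) : Equiv.Perm (Labeling V n) :=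
  tproPerm G (exists_alpha_eq β).choose

theorem toggle_commute {V : Type*} {n : ℕ} (G : SimpleGraph V) {i j : ZMod n}
    (h : ¬ (cycle n).Adj i j) : Commute (toggle G i : Equiv.Perm (Labeling V n)) (toggle G j) := by
  by_cases hij : i = j
  · subst hij
    exact Commute.refl _
  have h1 : i + 1 ≠ j := by
    rintro rfl
    exact h (by simp [cycle]; simpa using hij)
  have h2 : j + 1 ≠ i := by
    rintro rfl
    exact h (by simp [cycle]; simpa using hij)
  have h3 : i + 1 ≠ j + 1 := fun e => hij (add_right_cancel e)
  have key : ∀ σ : Labeling V n,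
      toggleFun G i (toggleFun G j σ) = toggleFun G j (toggleFun G i σ) := by
    intro σ
    have a1 := Equiv.swap_apply_of_ne_of_ne hij h2.symm
    have a2 := Equiv.swap_apply_of_ne_of_ne h1 h3
    have b1 := Equiv.swap_apply_of_ne_of_ne (Ne.symm hij) h1.symm
    have b2 := Equiv.swap_apply_of_ne_of_ne h2 h3.symm
    have hd : Equiv.Perm.Disjoint (Equiv.swap i (i + 1)) (Equiv.swap j (j + 1)) := by
      intro x
      by_cases hx : x = i
      · subst hx; exact Or.inr a1
      by_cases hx' : x = i + 1
      · subst hx'; exact Or.inr a2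
      exact Or.inl (Equiv.swap_apply_of_ne_of_ne hx hx')
    have hc : ∀ x, Equiv.swap i (i + 1) (Equiv.swap j (j + 1) x)
        = Equiv.swap j (j + 1) (Equiv.swap i (i + 1) x) := fun x => DFunLike.congr_fun hd.commute.eq x
    by_cases p : G.Adj (σ.symm i) (σ.symm (i + 1)) <;>
    by_cases q : G.Adj (σ.symm j) (σ.symm (j + 1)) <;>
    · ext v
      simp [toggleFun, p, q, a1, a2, b1, b2, hc]
  exact Equiv.ext key

/-- If two duplicate-free words with the same letters agree on the relative order of
any two letters whose images do not commute, then they have the same product. -/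
theorem prod_map_eq_of_order {ι M : Type*} [Monoid M] (f : ι → M) (l₁ : List ι) :
    ∀ l₂ : List ι, l₁.Perm l₂ → l₁.Nodup →
      (∀ x y, [x, y].Sublist l₁ → [y, x].Sublist l₂ → Commute (f x) (f y)) →
      (l₁.map f).prod = (l₂.map f).prod := by
  induction l₁ with
  | nil =>
    intro l₂ hp _ _
    rw [List.nil_perm.1 hp]
  | cons a t ih =>
    intro l₂ hp hnd hc
    obtain ⟨s, u, rfl⟩ := List.append_of_mem (hp.subset List.mem_cons_self)
    have hp' : t.Perm (s ++ u) :=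
      (List.perm_cons a).1 (hp.trans List.perm_middle)
    have hat : a ∉ t := (List.nodup_cons.1 hnd).1
    have hs : Commute (s.map f).prod (f a) := by
      apply Commute.list_prod_left
      intro y hy
      obtain ⟨x, hx, rfl⟩ := List.mem_map.1 hy
      have hxt : x ∈ t := hp'.symm.subset (List.mem_append_left _ hx)
      refine (hc a x ?_ ?_).symm
      · exact (List.singleton_sublist.2 hxt).cons_cons a
      · have := (List.singleton_sublist.2 hx).append
          (List.singleton_sublist.2 (List.mem_cons_self : a ∈ a :: u))
        simpa using this
    have := ih (s ++ u) hp' (List.nodup_cons.1 hnd).2 fun x y h1 h2 =>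
      hc x y (h1.cons a) (h2.trans ((List.sublist_cons_self a u).append_left s))
    simp only [List.map_append, List.map_cons, List.prod_append, List.prod_cons] at this ⊢
    rw [this, ← mul_assoc, ← mul_assoc, hs.eq]

theorem sublist_map_finRange {n : ℕ} (π : Fin n ≃ ZMod n) {x y : ZMod n}
    (h : [x, y].Sublist ((List.finRange n).map π)) : π.symm x < π.symm y := by
  have hp : ((List.finRange n).map π).Pairwise fun a b => π.symm a < π.symm b := by
    rw [List.pairwise_map]
    simpa using List.pairwise_lt_finRange n
  simpa using hp.sublist h

/-- `TPro_π` depends only on the acyclic orientation `α_π`. -/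
theorem tproPerm_eq_of_alpha_eq {V : Type*} {n : ℕ} [NeZero n] (G : SimpleGraph V)
    {π π' : Fin n ≃ ZMod n} (h : alpha π = alpha π') : tproPerm G π = tproPerm G π' := by
  have hnd : ∀ ρ : Fin n ≃ ZMod n, ((List.finRange n).map ρ).Nodup := fun ρ =>
    (List.nodup_finRange n).map ρ.injective
  have hmem : ∀ (ρ : Fin n ≃ ZMod n) x, x ∈ (List.finRange n).map ρ := fun ρ x =>
    List.mem_map.2 ⟨ρ.symm x, List.mem_finRange _, ρ.apply_symm_apply x⟩
  have e : ∀ ρ : Fin n ≃ ZMod n, tproPerm G ρ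
      = (((List.finRange n).map ρ).reverse.map (toggle (V := V) G)).prod := by
    intro ρ
    simp [tproPerm, List.ofFn_eq_map, List.map_reverse, Function.comp_def]
  rw [e, e]
  refine prod_map_eq_of_order _ _ _ ?_ (List.nodup_reverse.2 (hnd π)) ?_
  · refine (List.perm_ext_iff_of_nodup (List.nodup_reverse.2 (hnd π))
      (List.nodup_reverse.2 (hnd π'))).2 fun x => ?_
    simp only [List.mem_reverse, hmem]
  · intro x y h1 h2
    have h1' : π.symm y < π.symm x := sublist_map_finRange π (by simpa using h1.reverse)
    have h2' : π'.symm x < π'.symm y := sublist_map_finRange π' (by simpa using h2.reverse)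
    refine toggle_commute G fun hadj => ?_
    have hb : (alpha π').Adj x y := ⟨hadj, h2'⟩
    rw [← h] at hb
    exact lt_asymm hb.2 h1'

/-- `TPro_β = TPro_π` for every bijection `π` with `α_π = β`. -/
theorem tpro_eq_tproPerm {V : Type*} {n : ℕ} [NeZero n] (G : SimpleGraph V)
    {β : AcyclicOrientation (cycle n)} {π : Fin n ≃ ZMod n} (h : alpha π = β) :
    tpro G β = tproPerm G π :=
  tproPerm_eq_of_alpha_eq G ((exists_alpha_eq β).choose_spec.trans h.symm)

end Permutoric

/-!
Permutoric promotion is followed on the cycle `ℤ/nℤ`, whose points are the labels; a labeling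
places the vertices of the path on these points.  The points split into two classes that change
with time: `i` is a *stone* if, in the periodic sequence `π(1), …, π(n), π(1), …` of toggles, the
next occurrence of `i` comes before the next occurrence of `i - 1` (`stones`).  The toggle `τ_i`
occurs exactly when `i` is a stone and `i + 1` is not, and it exchanges the roles of these two
points (`preimage_stones`).  So stones only move clockwise, the other points move
counterclockwise, and after a full round both classes are back in place (`stones_end`); there are
`d` stones and `n - d` other points.

Say that the *leader* of a class is its point carrying the first vertex of the path among the
vertices carried by the class (`Leads`).  If `τ_i` swaps two labels, then the vertices carried by
a class do not change.  If it does not, then the vertex of the class at one end is replaced by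
an adjacent vertex that did not belong to the class; as the graph is a path, this does not change
the order of the vertices.  Either way the leader just moves along with its class
(`leads_toggle`).

In one round every stone advances to the starting position of the next stone, so the leading
stone advances by one step in the cyclic order of the `d` starting positions; this is measured by
a counting function with values in `ℤ/dℤ` (`exists_count`).  An orbit that returns to its start
after `k` rounds therefore has `d ∣ k`.  The same argument for the points that are not stones
gives `n - d ∣ k`.
-/

namespace Permutoric

/-! ### Orbits with a cyclic observable -/

/-- If each state `a` has a unique observable `x` (encoded by the relation `L a x`), and `g`
moves the value `r x ∈ ℤ/mℤ` by a fixed `ε = ± 1`, then `m` divides the size of every orbit. -/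
theorem dvd_ncard_orbit_of_step {α β : Type*} {m : ℕ} (g : Equiv.Perm α) (L : α → β → Prop)
    (hex : ∀ a, ∃ x, L a x) (huniq : ∀ a x y, L a x → L a y → x = y) (r : β → ZMod m)
    {ε : ZMod m} (hε : ε = 1 ∨ ε = -1)
    (hstep : ∀ a x, L a x → ∃ y, L (g a) y ∧ r y = r x + ε) (a : α) :
    m ∣ (MulAction.orbit (Subgroup.zpowers g) a).ncard := by
  have hiter : ∀ (k : ℕ) x, L a x → ∃ y, L ((g ^ k) a) y ∧ r y = r x + k * ε := by
    intro k x hx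
    induction k with
    | zero => exact ⟨x, by simpa using hx, by simp⟩
    | succ k ih =>
      obtain ⟨y, hy, hr⟩ := ih
      obtain ⟨z, hz, hr'⟩ := hstep _ _ hy
      refine ⟨z, by rwa [pow_succ', Equiv.Perm.mul_apply], ?_⟩
      rw [hr', hr]
      push_cast
      ring
  rw [← Nat.card_coe_set_eq, Nat.card_congr (MulAction.orbitZPowersEquiv g a), Nat.card_zmod]
  set k := Function.minimalPeriod (fun x => g • x) a with hk
  have hret : (g ^ k) a = a := by
    have := Function.iterate_minimalPeriod (f := fun x => g • x) (x := a)
    rw [← hk] at this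
    rw [Equiv.Perm.coe_pow]
    exact this
  obtain ⟨x, hx⟩ := hex a
  obtain ⟨y, hy, hr⟩ := hiter k x hx
  rw [hret] at hy
  obtain rfl := huniq _ _ _ hx hy
  have h0 : (k : ZMod m) * ε = 0 := by simpa using hr
  rw [← ZMod.natCast_eq_zero_iff]
  rcases hε with rfl | rfl <;> simpa using h0

/-- Induction along the factors of a product of permutations, the first factor acting first. -/
theorem reverse_prod_ofFn_induction {α : Type*} {n : ℕ} (f : Fin n → Equiv.Perm α)
    (I : ℕ → α → Prop) (h : ∀ (k : Fin n) a, I k a → I (k + 1) (f k a)) (a : α) (h0 : I 0 a) :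
    I n ((List.ofFn f).reverse.prod a) := by
  induction n with
  | zero => simpa using h0
  | succ n ih =>
    have := h (Fin.last n) _ (ih (fun k => f k.castSucc) fun k => h k.castSucc)
    rw [List.ofFn_succ', List.concat_eq_append, List.reverse_append, List.reverse_singleton,
      List.singleton_append, List.prod_cons, Equiv.Perm.mul_apply]
    exact this

/-- The elements of `T` met while walking clockwise around the cycle can be counted modulo the
size of `T`. -/
theorem exists_count {n : ℕ} [NeZero n] (T : Set (ZMod n)) {m : ℕ} (hT : T.ncard = m) :
    ∃ r : ZMod n → ZMod m,
      (∀ i, i ∈ T → r (i + 1) = r i + 1) ∧ ∀ i, i ∉ T → r (i + 1) = r i := by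
  classical
  let c : ℕ → ℕ := fun k => {j ∈ T | j.val < k}.ncard
  have hin : ∀ i, i ∈ T → c (i.val + 1) = c i.val + 1 := by
    intro i hi
    have : {j ∈ T | j.val < i.val + 1} = insert i {j ∈ T | j.val < i.val} := by
      ext j
      by_cases hj : j = i
      · simp [hj, hi]
      · have : j.val ≠ i.val := fun e => hj (ZMod.val_injective n e)
        simp only [Set.mem_ofPred_eq, Set.mem_insert_iff, hj, false_or, and_congr_right_iff]
        omega
    simp only [c, this]
    exact Set.ncard_insert_of_notMem (by simp) (Set.toFinite _)
  have hout : ∀ i, i ∉ T → c (i.val + 1) = c i.val := by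
    intro i hi
    have : {j ∈ T | j.val < i.val + 1} = {j ∈ T | j.val < i.val} := by
      ext j
      simp only [Set.mem_ofPred_eq, and_congr_right_iff]
      intro hj
      have : j.val ≠ i.val := fun e => hi (ZMod.val_injective n e ▸ hj)
      omega
    simp only [c, this]
  -- Passing from `n - 1` to `0` drops the count by `m`, which is invisible modulo `m`.
  have hwrap : ∀ i : ZMod n, (c (i + 1).val : ZMod m) = c (i.val + 1) := by
    intro i
    rcases Nat.lt_or_ge (i.val + 1) n with h | h
    · have : (i + 1).val = i.val + 1 := by
        rw [ZMod.val_add, ZMod.val_one_eq_one_mod, Nat.add_mod_mod, Nat.mod_eq_of_lt h]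
      rw [this]
    · have hn : i.val + 1 = n := le_antisymm (ZMod.val_lt i) h
      have h0 : (i + 1).val = 0 := by
        rw [ZMod.val_add, ZMod.val_one_eq_one_mod, Nat.add_mod_mod, hn, Nat.mod_self]
      have h1 : c 0 = 0 := by simp [c]
      have h2 : c n = m := by simp [c, ZMod.val_lt, hT]
      rw [h0, hn, h1, h2]
      simp
  refine ⟨fun i => c i.val, fun i hi => ?_, fun i hi => ?_⟩
  · simp only [hwrap, hin i hi]
    push_cast
    rfl
  · simp only [hwrap, hout i hi]

/-! ### The leader of a set of labels -/

/-- The label `x` leads the set `T` of labels: among the vertices with labels in `T`, the first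
one along the path has the label `x`. -/
def Leads {n : ℕ} (σ : Labeling (Fin n) n) (T : Set (ZMod n)) (x : ZMod n) : Prop :=
  x ∈ T ∧ ∀ y ∈ T, σ.symm x ≤ σ.symm y

theorem exists_leads {n : ℕ} (σ : Labeling (Fin n) n) {T : Set (ZMod n)} (hT : T.Nonempty) :
    ∃ x, Leads σ T x := by
  obtain ⟨v, ⟨x, hx, rfl⟩, hmin⟩ :=
    Set.exists_min_image (σ.symm '' T) id (Set.toFinite _) (hT.image _)
  exact ⟨x, hx, fun y hy => hmin _ ⟨y, hy, rfl⟩⟩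

theorem Leads.unique {n : ℕ} {σ : Labeling (Fin n) n} {T : Set (ZMod n)} {x y : ZMod n}
    (hx : Leads σ T x) (hy : Leads σ T y) : x = y :=
  σ.symm.injective (le_antisymm (hx.2 y hy.1) (hy.2 x hx.1))

/-- A toggle `τ_i` that exchanges a member of `T` with a non-member takes the leader along.
This is where the graph being a path matters: replacing a vertex by an adjacent one preserves
its order relative to all other vertices. -/
theorem leads_toggle {n : ℕ} {σ : Labeling (Fin n) n} {T : Set (ZMod n)} {x i : ZMod n}
    (hx : Leads σ T x) (hi : i ∈ T ↔ i + 1 ∉ T) :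
    Leads (toggle (SimpleGraph.pathGraph n) i σ) (Equiv.swap i (i + 1) ⁻¹' T)
      (Equiv.swap i (i + 1) x) := by
  refine ⟨by simpa using hx.1, fun y hy => ?_⟩
  change (toggleFun _ i σ).symm _ ≤ (toggleFun _ i σ).symm _
  obtain ⟨z, rfl⟩ := (Equiv.swap i (i + 1)).surjective y
  have hz : z ∈ T := by simpa using hy
  have hle := hx.2 z hz
  by_cases hadj : (SimpleGraph.pathGraph n).Adj (σ.symm i) (σ.symm (i + 1))
  · simp only [toggleFun, hadj, if_true]
    rw [SimpleGraph.pathGraph_adj] at hadj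
    have hlt : x ≠ z → (σ.symm x).val < (σ.symm z).val := fun e =>
      lt_of_le_of_ne hle fun h => e (σ.symm.injective (Fin.ext h))
    have hxT := hx.1
    rw [Fin.le_def]
    by_cases hxz : x = z
    · rw [hxz]
    specialize hlt hxz
    by_cases hxi : x = i
    · subst hxi
      have hzi : z ≠ x + 1 := fun e => hi.1 hxT (e ▸ hz)
      rw [Equiv.swap_apply_left, Equiv.swap_apply_of_ne_of_ne (Ne.symm hxz) hzi]
      omega
    by_cases hxi' : x = i + 1
    · subst hxi'
      have hzi : z ≠ i := fun e => hi.1 (e ▸ hz) hxT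
      rw [Equiv.swap_apply_right, Equiv.swap_apply_of_ne_of_ne hzi (Ne.symm hxz)]
      omega
    rw [Equiv.swap_apply_of_ne_of_ne hxi hxi']
    by_cases hzi : z = i
    · subst hzi
      rw [Equiv.swap_apply_left]
      omega
    by_cases hzi' : z = i + 1
    · subst hzi'
      rw [Equiv.swap_apply_right]
      omega
    rw [Equiv.swap_apply_of_ne_of_ne hzi hzi']
    exact hlt.le
  · simp [toggleFun, hadj, hle]

/-! ### The motion of the stones -/

/-- The time of the next occurrence of the toggle `i`, from time `t ≤ n` on, in the periodic
sequence `π 0, …, π (n - 1), π 0, …`. -/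
def nextTime {n : ℕ} (π : Fin n ≃ ZMod n) (t : ℕ) (i : ZMod n) : ℕ :=
  if (π.symm i).val < t then (π.symm i).val + n else (π.symm i).val

/-- The set of stones at time `t`: the points `i` at which the next toggle to involve the label
`i` is `τ_i` and not `τ_{i - 1}`. -/
def stones {n : ℕ} (π : Fin n ≃ ZMod n) (t : ℕ) : Set (ZMod n) :=
  {i | nextTime π t i < nextTime π t (i - 1)}

theorem add_one_ne {n : ℕ} (hn : 2 ≤ n) (i : ZMod n) : i + 1 ≠ i := by
  have : Fact (1 < n) := ⟨hn⟩
  simp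

theorem nextTime_lt {n : ℕ} (π : Fin n ≃ ZMod n) (k : Fin n) {j : ZMod n} (h : j ≠ π k) :
    nextTime π k (π k) < nextTime π k j := by
  have hne : (π.symm j).val ≠ k := fun e => h (by rw [← Fin.ext e]; simp)
  have h2 := (π.symm j).isLt
  have h3 := k.isLt
  simp only [nextTime, Equiv.symm_apply_apply]
  split_ifs <;> omega

theorem nextTime_succ_lt {n : ℕ} (π : Fin n ≃ ZMod n) (k : Fin n) {j : ZMod n} (h : j ≠ π k) :
    nextTime π (k + 1) j < nextTime π (k + 1) (π k) := by
  have hne : (π.symm j).val ≠ k := fun e => h (by rw [← Fin.ext e]; simp)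
  have h2 := (π.symm j).isLt
  have h3 := k.isLt
  simp only [nextTime, Equiv.symm_apply_apply]
  split_ifs <;> omega

theorem nextTime_succ {n : ℕ} (π : Fin n ≃ ZMod n) (k : Fin n) {j : ZMod n} (h : j ≠ π k) :
    nextTime π (k + 1) j = nextTime π k j := by
  have hne : (π.symm j).val ≠ k := fun e => h (by rw [← Fin.ext e]; simp)
  simp only [nextTime]
  split_ifs <;> omega

theorem mem_stones {n : ℕ} (hn : 2 ≤ n) (π : Fin n ≃ ZMod n) (k : Fin n) : π k ∈ stones π k :=
  nextTime_lt π k fun e => add_one_ne hn (π k - 1) (by rw [sub_add_cancel, e])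

theorem add_one_notMem_stones {n : ℕ} (hn : 2 ≤ n) (π : Fin n ≃ ZMod n) (k : Fin n) :
    π k + 1 ∉ stones π k := by
  intro h
  have h' := nextTime_lt π k (add_one_ne hn (π k))
  rw [stones, Set.mem_ofPred_eq, add_sub_cancel_right] at h
  exact lt_asymm h h'

/-- The toggle at time `k` moves the stone at `π k` to the point `π k + 1`. -/
theorem preimage_stones {n : ℕ} (hn : 2 ≤ n) (π : Fin n ≃ ZMod n) (k : Fin n) :
    Equiv.swap (π k) (π k + 1) ⁻¹' stones π k = stones π (k + 1) := by
  ext y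
  rw [Set.mem_preimage]
  by_cases h1 : y = π k
  · subst h1
    rw [Equiv.swap_apply_left]
    have hne : π k - 1 ≠ π k := fun e => add_one_ne hn (π k - 1) (by rw [sub_add_cancel, e])
    exact iff_of_false (add_one_notMem_stones hn π k) (lt_asymm (nextTime_succ_lt π k hne))
  by_cases h2 : y = π k + 1
  · subst h2
    rw [Equiv.swap_apply_right]
    refine iff_of_true (mem_stones hn π k) ?_
    rw [stones, Set.mem_ofPred_eq, add_sub_cancel_right]
    exact nextTime_succ_lt π k h1
  have h3 : y - 1 ≠ π k := fun e => h2 (by rw [← e, sub_add_cancel])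
  rw [Equiv.swap_apply_of_ne_of_ne h1 h2, stones, stones, Set.mem_ofPred_eq, Set.mem_ofPred_eq,
    nextTime_succ π k h1, nextTime_succ π k h3]

theorem stones_end {n : ℕ} (π : Fin n ≃ ZMod n) : stones π n = stones π 0 := by
  ext i
  simp [stones, nextTime]

/-! ### One round of permutoric promotion -/

theorem symm_apply_val_ne {n : ℕ} (π : Fin n ≃ ZMod n) {k : Fin n} {j : ZMod n} (h : j ≠ π k) :
    (π.symm j).val ≠ k := fun e => h (by rw [← Fin.ext e]; simp)

/-- In one round, the leading stone advances to the next starting position of a stone. -/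
theorem exists_leads_stones_tproPerm {n m : ℕ} (hn : 2 ≤ n) (π : Fin n ≃ ZMod n)
    {r : ZMod n → ZMod m}
    (hin : ∀ i, π.symm (i + 1) < π.symm i → r (i + 1) = r i + 1)
    (hout : ∀ i, ¬ π.symm (i + 1) < π.symm i → r (i + 1) = r i)
    (σ : Labeling (Fin n) n) (x : ZMod n) (hx : Leads σ (stones π 0) x) :
    ∃ y, Leads (tproPerm (SimpleGraph.pathGraph n) π σ) (stones π 0) y ∧ r y = r x + 1 := by
  -- A stone whose position `y` has already been toggled has reached its final position.
  have key := reverse_prod_ofFn_induction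
    (fun k => toggle (SimpleGraph.pathGraph n) (π k))
    (fun t σ' => ∃ y, Leads σ' (stones π t) y ∧
      r y = r x + if (π.symm y).val < t then 1 else 0) ?_ σ ⟨x, hx, by simp⟩
  · obtain ⟨y, hy, hr⟩ := key
    rw [if_pos (π.symm y).isLt] at hr
    exact ⟨y, by rwa [stones_end] at hy, hr⟩
  · rintro k σ' ⟨y, hy, hr⟩
    have hl := leads_toggle hy
      (iff_of_true (mem_stones hn π k) (add_one_notMem_stones hn π k))
    rw [preimage_stones hn] at hl
    refine ⟨_, hl, ?_⟩
    by_cases h1 : y = π k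
    · subst h1
      have hne := symm_apply_val_ne π (add_one_ne hn (π k))
      rw [Equiv.swap_apply_left]
      rw [Equiv.symm_apply_apply, if_neg (lt_irrefl _), add_zero] at hr
      by_cases hlt : π.symm (π k + 1) < π.symm (π k)
      · rw [hin _ hlt, hr, if_pos]
        rw [Equiv.symm_apply_apply, Fin.lt_def] at hlt
        omega
      · rw [hout _ hlt, hr, if_neg, add_zero]
        rw [Equiv.symm_apply_apply, Fin.lt_def] at hlt
        omega
    · have h2 : y ≠ π k + 1 := fun e => add_one_notMem_stones hn π k (e ▸ hy.1)
      have hne := symm_apply_val_ne π h1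
      have hiff : (π.symm y).val < k + 1 ↔ (π.symm y).val < k := by omega
      simp only [Equiv.swap_apply_of_ne_of_ne h1 h2, hr, hiff]

/-- In one round, the leader of the points that are not stones moves counterclockwise to the next
starting position of such a point. -/
theorem exists_leads_compl_stones_tproPerm {n m : ℕ} (hn : 2 ≤ n) (π : Fin n ≃ ZMod n)
    {r : ZMod n → ZMod m}
    (hin : ∀ i, ¬ π.symm (i + 1) < π.symm i → r (i + 1) = r i + 1)
    (hout : ∀ i, π.symm (i + 1) < π.symm i → r (i + 1) = r i)
    (σ : Labeling (Fin n) n) (x : ZMod n) (hx : Leads σ (stones π 0)ᶜ x) :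
    ∃ y, Leads (tproPerm (SimpleGraph.pathGraph n) π σ) (stones π 0)ᶜ y ∧
      r (y - 1) = r (x - 1) + -1 := by
  -- A point `y` of the complement moves when the toggle `y - 1` occurs, which explains the shift.
  have key := reverse_prod_ofFn_induction
    (fun k => toggle (SimpleGraph.pathGraph n) (π k))
    (fun t σ' => ∃ y, Leads σ' (stones π t)ᶜ y ∧
      (r (y - 1) + if (π.symm (y - 1)).val < t then 1 else 0) = r (x - 1)) ?_ σ
    ⟨x, hx, by simp⟩
  · obtain ⟨y, hy, hr⟩ := key
    rw [if_pos (π.symm (y - 1)).isLt] at hr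
    exact ⟨y, by rwa [stones_end] at hy, by rw [← hr, add_neg_cancel_right]⟩
  · rintro k σ' ⟨y, hy, hr⟩
    have hl := leads_toggle hy (iff_of_false (not_not.2 (mem_stones hn π k))
      (not_not.2 (add_one_notMem_stones hn π k)))
    rw [Set.preimage_compl, preimage_stones hn] at hl
    refine ⟨_, hl, ?_⟩
    by_cases h1 : y = π k + 1
    · subst h1
      have hne := symm_apply_val_ne π (k := k) (j := π k - 1) fun e =>
        add_one_ne hn (π k - 1) (by rw [sub_add_cancel, e])
      rw [Equiv.swap_apply_right]
      rw [add_sub_cancel_right, Equiv.symm_apply_apply, if_neg (lt_irrefl _), add_zero] at hr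
      have hin' := hin (π k - 1)
      have hout' := hout (π k - 1)
      rw [sub_add_cancel, Equiv.symm_apply_apply, Fin.lt_def] at hin' hout'
      by_cases hlt : k.val < (π.symm (π k - 1)).val
      · rw [← hr, hout' hlt, if_neg (by omega), add_zero]
      · rw [← hr, hin' hlt, if_pos (by omega)]
    · have h2 : y ≠ π k := fun e => hy.1 (e ▸ mem_stones hn π k)
      have hne := symm_apply_val_ne π (k := k) (j := y - 1) fun e =>
        h1 (by rw [← e, sub_add_cancel])
      have hiff : (π.symm (y - 1)).val < k + 1 ↔ (π.symm (y - 1)).val < k := by omega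
      rw [Equiv.swap_apply_of_ne_of_ne h2 h1, ← hr]
      simp only [hiff]

end Permutoric

theorem proposition5p1 (n : ℕ) [NeZero n] (hn : 2 ≤ n)
    (β : Permutoric.AcyclicOrientation (Permutoric.cycle n)) (d : ℕ)
    (hd : Permutoric.numCounterclockwise β = d)
    (σ : Permutoric.Labeling (Fin n) n) :
    Nat.lcm d (n - d) ∣
      (MulAction.orbit (Subgroup.zpowers (Permutoric.tpro (SimpleGraph.pathGraph n) β)) σ).ncard := by
  open Permutoric in
  obtain ⟨π, hπ⟩ := exists_alpha_eq β
  rw [tpro_eq_tproPerm _ hπ]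
  have hT : {i : ZMod n | π.symm (i + 1) < π.symm i}.ncard = d := by
    rw [← hd, numCounterclockwise, ← hπ]
    congr 1
    ext i
    have hadj : (cycle n).Adj (i + 1) i := by
      have := add_one_ne hn i
      simp [cycle, this]
    exact ⟨fun h => ⟨hadj, h⟩, fun h => h.2⟩
  have hTc : {i : ZMod n | π.symm (i + 1) < π.symm i}ᶜ.ncard = n - d := by
    rw [Set.ncard_compl, hT, Nat.card_zmod]
  have h0 : 0 < n := by omega
  refine Nat.lcm_dvd ?_ ?_
  · obtain ⟨r, hin, hout⟩ := exists_count _ hT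
    exact dvd_ncard_orbit_of_step _ (fun σ x => Leads σ (stones π 0) x)
      (fun σ => exists_leads σ ⟨_, mem_stones hn π ⟨0, h0⟩⟩) (fun _ _ _ h h' => h.unique h') r
      (Or.inl rfl) (exists_leads_stones_tproPerm hn π hin hout) σ
  · obtain ⟨r, hin, hout⟩ := exists_count _ hTc
    exact dvd_ncard_orbit_of_step _ (fun σ x => Leads σ (stones π 0)ᶜ x)
      (fun σ => exists_leads σ ⟨_, add_one_notMem_stones hn π ⟨0, h0⟩⟩)
      (fun _ _ _ h h' => h.unique h') (fun y => r (y - 1)) (Or.inr rfl)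
      (exists_leads_compl_stones_tproPerm hn π hin fun i hi => hout i (not_not.2 hi)) σ
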